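/- **Setting.** A realization is a tuple $(\mathcal H,\rho,H,M)$ of a complex Hilbert space, a density operator $\rho$, a self-adjoint (possibly unbounded) operator $H\ge 0$ and a two-outcome POVM $M=(M_0,M_1)$. Its timeline is $P(a|t)=\mathrm{tr}(e^{-iHt}\rho e^{iHt}M_a)$, $a\in\{0,1\}$, $t\in\mathbb R$. For $E^+>0$ let $S(E^+;\tfrac12)$ be the set of timelines of realizations in which the energy of $\rho$ is above or equal to $E^+$ with probability at most $\tfrac12$, i.e. $\mathrm{tr}(\rho\,\mathbf 1_{[E^+,\infty)}(H))\le\tfrac12$; for $\vec t=(t_1,\dots,t_N)$ let $S(E^+;\tfrac12,\vec t)$ be the set of datasets $(P(a|t_j))_{a,j}$ with $P\in S(E^+;\tfrac12)$. For $\Delta>0$ and $\delta\ge0$ we say that $P$ fits $(\tilde P,\delta)$ if $\sum_a|P(a|t_j)-\tilde P(a|t_j)|\le\delta$ for $t_1=0$, $t_2=\Delta$, where $\tilde P(0|0)=1$, $\tilde P(1|0)=0$, $\tilde P(0|\Delta)=0$, $\tilde P(1|\Delta)=1$. Let $\tau_m=2\Delta+\frac{\Delta}{2m+1}$, $m=0,1,2,\dots$,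 so that $\tau_m\to2\Delta$. **Statement.** 1. There are absolute constants $C_1,C_2>0$ such that for all $E^+>0$, $0<\Delta\le\frac{\pi}{2E^+}$, $\delta\ge0$ and every $P\in S(E^+;\tfrac12)$ that fits $(\tilde P,\delta)$, $$1-P(0|2\Delta)\le\sqrt{C_1\sqrt\delta+C_2(E^+\Delta)^2}.$$ 2. For all $E^+,\Delta>0$ and all $m$, the realization $(\mathbb C^2,|+\rangle\langle+|,H_m,M)$ with $|+\rangle=\frac1{\sqrt2}(|0\rangle+|1\rangle)$, $H_m=\frac{(2m+1)\pi}{\Delta}|1\rangle\langle1|$, $M_0=|+\rangle\langle+|$, $M_1=\mathbb I-M_0$ satisfies the energy constraint of $S(E^+;\tfrac12)$, and its timeline $P_m$ fits $\tilde P$ exactly and has $P_m(0|\tau_m)=0$. Consequently, for every $\delta\ge0$, the minimum of $P(0|\tau_m)$ over all $P\in S(E^+;\tfrac12)$ that fit $(\tilde P,\delta)$ is $0$, and the dataset $D$ with $D(0|\cdot)=(1,0,0)$, $D(1|\cdot)=(0,1,1)$ lies in $S(E^+;\tfrac12,(0,\Delta,\tau_m))$ for every $m$. 3. There is an absolute constant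 $c>0$ such that, whenever $E^+,\Delta>0$ and $E^+\Delta\le c$, the dataset $D$ is not in the closure of $S(E^+;\tfrac12,(0,\Delta,2\Delta))$, and the set-valued map $\vec t\mapsto S(E^+;\tfrac12,\vec t)$, $\vec t\in\mathbb R^3$, is not continuous at $\vec t=(0,\Delta,2\Delta)$ in the Hausdorff distance. -/

import Mathlib

open MeasureTheory Filter Topology

noncomputable section

namespace TimedMeasurement

/-- A spectral measure on `ℝ` (a projection-valued measure, or resolution of the identity): to each
Borel set `A` it assigns an orthogonal projection `proj A`, countably additively in the strong
operator topology.  The values on non-measurable sets play no role. -/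
structure SpectralMeasure (𝓗 : Type*) [NormedAddCommGroup 𝓗] [InnerProductSpace ℂ 𝓗]
    [CompleteSpace 𝓗] where
  proj : Set ℝ → 𝓗 →L[ℂ] 𝓗
  isStarProjection : ∀ A, MeasurableSet A → IsStarProjection (proj A)
  proj_univ : proj Set.univ = 1
  proj_inter : ∀ A B, MeasurableSet A → MeasurableSet B → proj (A ∩ B) = proj A * proj B
  hasSum_iUnion : ∀ A : ℕ → Set ℝ, (∀ n, MeasurableSet (A n)) →
    Pairwise (Function.onFun Disjoint A) →
      ∀ ψ : 𝓗, HasSum (fun n => proj (A n) ψ) (proj (⋃ n, A n) ψ)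

namespace SpectralMeasure

variable {𝓗 : Type*} [NormedAddCommGroup 𝓗] [InnerProductSpace ℂ 𝓗] [CompleteSpace 𝓗]

theorem proj_empty (E : SpectralMeasure 𝓗) : E.proj ∅ = 0 := by
  ext ψ
  have h := E.hasSum_iUnion (fun _ => ∅) (fun _ => MeasurableSet.empty)
    (fun _ _ _ => by simp [Function.onFun]) ψ
  have h2 := h.summable.tendsto_atTop_zero
  simpa using (tendsto_nhds_unique h2 tendsto_const_nhds).symm

theorem inner_proj (E : SpectralMeasure 𝓗) {A : Set ℝ} (hA : MeasurableSet A) (ψ : 𝓗) :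
    inner ℂ ψ (E.proj A ψ) = ((‖E.proj A ψ‖ ^ 2 : ℝ) : ℂ) := by
  have h1 : E.proj A (E.proj A ψ) = E.proj A ψ := by
    have := (E.isStarProjection A hA).isIdempotentElem
    exact congrArg (fun T : 𝓗 →L[ℂ] 𝓗 => T ψ) this
  have h2 : ContinuousLinearMap.adjoint (E.proj A) = E.proj A :=
    (E.isStarProjection A hA).isSelfAdjoint
  rw [← h1, ← ContinuousLinearMap.adjoint_inner_left, h2, h1, inner_self_eq_norm_sq_to_K]
  norm_cast

/-- The energy distribution `A ↦ ‖E(A)ψ‖² = ⟨ψ, E(A)ψ⟩` of the vector `ψ`. -/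
def measure (E : SpectralMeasure 𝓗) (ψ : 𝓗) : Measure ℝ :=
  Measure.ofMeasurable (fun A _ => ENNReal.ofReal (‖E.proj A ψ‖ ^ 2))
    (by simp [E.proj_empty])
    (by
      intro A hA hd
      have h := (E.hasSum_iUnion A hA hd ψ).mapL (innerSL ℂ ψ)
      simp only [innerSL_apply_apply] at h
      rw [E.inner_proj (MeasurableSet.iUnion hA)] at h
      simp only [E.inner_proj (hA _)] at h
      have h' := Complex.hasSum_ofReal.mp h
      rw [← h'.tsum_eq]
      exact ENNReal.ofReal_tsum_of_nonneg (fun n => by positivity) h'.summable)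

theorem measure_apply (E : SpectralMeasure 𝓗) (ψ : 𝓗) {A : Set ℝ} (hA : MeasurableSet A) :
    E.measure ψ A = ENNReal.ofReal (‖E.proj A ψ‖ ^ 2) :=
  Measure.ofMeasurable_apply A hA

theorem measureReal_apply (E : SpectralMeasure 𝓗) (ψ : 𝓗) {A : Set ℝ} (hA : MeasurableSet A) :
    (E.measure ψ).real A = ‖E.proj A ψ‖ ^ 2 := by
  rw [Measure.real, E.measure_apply ψ hA, ENNReal.toReal_ofReal (by positivity)]

instance (E : SpectralMeasure 𝓗) (ψ : 𝓗) : IsFiniteMeasure (E.measure ψ) :=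
  ⟨by rw [E.measure_apply ψ MeasurableSet.univ]; exact ENNReal.ofReal_lt_top⟩

/-- The integral of a simple function against a spectral measure. -/
def simpleIntegral (E : SpectralMeasure 𝓗) (s : SimpleFunc ℝ ℂ) : 𝓗 →L[ℂ] 𝓗 :=
  ∑ c ∈ s.range, c • E.proj (s ⁻¹' {c})

theorem inner_simpleIntegral (E : SpectralMeasure 𝓗) (s : SimpleFunc ℝ ℂ) (ψ : 𝓗) :
    inner ℂ ψ (E.simpleIntegral s ψ) = ∫ l, s l ∂(E.measure ψ) := by
  classical
  rw [← SimpleFunc.integral_eq_integral _ (SimpleFunc.integrable_of_isFiniteMeasure s),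
    SimpleFunc.integral_eq_sum_of_subset (Finset.filter_subset _ _), simpleIntegral]
  simp only [sum_apply, smul_apply, inner_sum,
    inner_smul_right]
  refine Finset.sum_congr rfl fun c _ => ?_
  rw [E.inner_proj (s.measurableSet_fiber c), E.measureReal_apply ψ (s.measurableSet_fiber c),
    Complex.real_smul, mul_comm]

theorem simpleIntegral_sub (E : SpectralMeasure 𝓗) (s s' : SimpleFunc ℝ ℂ) :
    E.simpleIntegral (s - s') = E.simpleIntegral s - E.simpleIntegral s' := by
  apply ContinuousLinearMap.coe_injective
  rw [← ext_inner_map]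
  intro ψ
  rw [← inner_conj_symm, ← inner_conj_symm (_ : 𝓗) ψ]
  congr 1
  simp only [ContinuousLinearMap.coe_coe, sub_apply, inner_sub_right,
    inner_simpleIntegral, SimpleFunc.coe_sub, Pi.sub_apply]
  exact integral_sub (SimpleFunc.integrable_of_isFiniteMeasure s)
    (SimpleFunc.integrable_of_isFiniteMeasure s')

theorem norm_simpleIntegral_sq (E : SpectralMeasure 𝓗) (s : SimpleFunc ℝ ℂ) (ψ : 𝓗) :
    ‖E.simpleIntegral s ψ‖ ^ 2 = ∫ l, ‖s l‖ ^ 2 ∂(E.measure ψ) := by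
  classical
  have horth : ∀ c d : ℂ, c ≠ d →
      inner ℂ (E.proj (s ⁻¹' {c}) ψ) (E.proj (s ⁻¹' {d}) ψ) = 0 := by
    intro c d hcd
    have h2 : ContinuousLinearMap.adjoint (E.proj (s ⁻¹' {c})) = E.proj (s ⁻¹' {c}) :=
      (E.isStarProjection _ (s.measurableSet_fiber c)).isSelfAdjoint
    have h3 : E.proj (s ⁻¹' {c}) * E.proj (s ⁻¹' {d}) = 0 := by
      rw [← E.proj_inter _ _ (s.measurableSet_fiber c) (s.measurableSet_fiber d),
        ← Set.preimage_inter, Set.singleton_inter_eq_empty.mpr (by simpa using hcd),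
        Set.preimage_empty, E.proj_empty]
    rw [← h2, ContinuousLinearMap.adjoint_inner_left]
    have h4 : E.proj (s ⁻¹' {c}) (E.proj (s ⁻¹' {d}) ψ) = 0 :=
      congrArg (fun T : 𝓗 →L[ℂ] 𝓗 => T ψ) h3
    rw [h4, inner_zero_right]
  have key : ((‖E.simpleIntegral s ψ‖ ^ 2 : ℝ) : ℂ)
      = ((∑ c ∈ s.range, (E.measure ψ).real (s ⁻¹' {c}) • ‖c‖ ^ 2 : ℝ) : ℂ) := by
    have : ((‖E.simpleIntegral s ψ‖ ^ 2 : ℝ) : ℂ)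
        = inner ℂ (E.simpleIntegral s ψ) (E.simpleIntegral s ψ) := by
      rw [inner_self_eq_norm_sq_to_K]; norm_cast
    rw [this, simpleIntegral]
    simp only [sum_apply, smul_apply, sum_inner, inner_sum,
      inner_smul_right, inner_smul_left, Complex.ofReal_sum]
    refine Finset.sum_congr rfl fun c hc => ?_
    rw [Finset.sum_eq_single c]
    · rw [inner_self_eq_norm_sq_to_K, E.measureReal_apply ψ (s.measurableSet_fiber c), ← mul_assoc,
        Complex.mul_conj, Complex.normSq_eq_norm_sq]
      simp [mul_comm]
    · intro d _ hd
      simp [horth _ _ hd]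
    · intro h; exact absurd hc h
  have key' := Complex.ofReal_injective key
  rw [key', ← SimpleFunc.map_integral s (fun c => ‖c‖ ^ 2)
    (SimpleFunc.integrable_of_isFiniteMeasure s) (by simp),
    SimpleFunc.integral_eq_integral _ (SimpleFunc.integrable_of_isFiniteMeasure _)]
  rfl

theorem exists_integral (E : SpectralMeasure 𝓗) (f : ℝ → ℂ) (hf : Measurable f)
    (hb : ∃ C, ∀ l, ‖f l‖ ≤ C) :
    ∃ T : 𝓗 →L[ℂ] 𝓗, ∀ ψ, inner ℂ ψ (T ψ) = ∫ l, f l ∂(E.measure ψ) := by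
  obtain ⟨C, hC⟩ := hb
  let s : ℕ → SimpleFunc ℝ ℂ := SimpleFunc.approxOn f hf Set.univ 0 (Set.mem_univ _)
  have hsb : ∀ n l, ‖s n l‖ ≤ 2 * C := fun n l => by
    have := SimpleFunc.norm_approxOn_zero_le hf (Set.mem_univ (0 : ℂ)) l n
    linarith [hC l]
  have hst : ∀ l, Tendsto (fun n => s n l) atTop (𝓝 (f l)) := fun l =>
    SimpleFunc.tendsto_approxOn hf (Set.mem_univ _) (by simp)
  have hC0 : 0 ≤ C := (norm_nonneg _).trans (hC 0)
  have hint : ∀ (ψ : 𝓗) (n : ℕ), Integrable (fun l => ‖s n l - f l‖ ^ 2) (E.measure ψ) := by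
    intro ψ n
    refine Integrable.of_bound (C := (3 * C) ^ 2)
      ((((s n).measurable.sub hf).norm.pow_const 2).aestronglyMeasurable) ?_
    refine Eventually.of_forall fun l => ?_
    rw [Real.norm_of_nonneg (by positivity)]
    gcongr
    exact (norm_sub_le _ _).trans (by linarith [hsb n l, hC l])
  have hL2 : ∀ ψ, Tendsto (fun n => ∫ l, ‖s n l - f l‖ ^ 2 ∂(E.measure ψ)) atTop (𝓝 0) := by
    intro ψ
    have : Tendsto (fun n => ∫ l, ‖s n l - f l‖ ^ 2 ∂(E.measure ψ)) atTop
        (𝓝 (∫ _, (0 : ℝ) ∂(E.measure ψ))) := by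
      refine tendsto_integral_of_dominated_convergence (fun _ => (3 * C) ^ 2)
        (fun n => (hint ψ n).aestronglyMeasurable) (integrable_const _) (fun n => ?_) ?_
      · refine Eventually.of_forall fun l => ?_
        rw [Real.norm_of_nonneg (by positivity)]
        gcongr
        exact (norm_sub_le _ _).trans (by linarith [hsb n l, hC l])
      · refine Eventually.of_forall fun l => ?_
        have h := ((hst l).sub_const (f l)).norm.pow 2
        simpa using h
    simpa using this
  have hcauchy : ∀ ψ, CauchySeq (fun n => E.simpleIntegral (s n) ψ) := by
    intro ψ
    rw [Metric.cauchySeq_iff]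
    intro ε hε
    obtain ⟨N, hN⟩ := (eventually_atTop.mp
      ((hL2 ψ).eventually (gt_mem_nhds (show (0 : ℝ) < ε ^ 2 / 4 by positivity))))
    refine ⟨N, fun m hm n hn => ?_⟩
    rw [dist_eq_norm, ← sub_apply, ← simpleIntegral_sub]
    refine lt_of_pow_lt_pow_left₀ 2 hε.le ?_
    rw [norm_simpleIntegral_sq]
    calc ∫ l, ‖(s m - s n) l‖ ^ 2 ∂(E.measure ψ)
        ≤ ∫ l, (2 * ‖s m l - f l‖ ^ 2 + 2 * ‖s n l - f l‖ ^ 2) ∂(E.measure ψ) := by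
          refine integral_mono_of_nonneg (Eventually.of_forall fun l => by positivity)
            (((hint ψ m).const_mul 2).add ((hint ψ n).const_mul 2))
            (Eventually.of_forall fun l => ?_)
          have h1 : ‖(s m - s n) l‖ ≤ ‖s m l - f l‖ + ‖s n l - f l‖ := by
            rw [SimpleFunc.coe_sub, Pi.sub_apply,
              show s m l - s n l = (s m l - f l) - (s n l - f l) by ring]
            exact norm_sub_le _ _
          have h2 := norm_nonneg ((s m - s n) l)
          simp only
          nlinarith [sq_nonneg (‖s m l - f l‖ - ‖s n l - f l‖)]
      _ = 2 * ∫ l, ‖s m l - f l‖ ^ 2 ∂(E.measure ψ)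
          + 2 * ∫ l, ‖s n l - f l‖ ^ 2 ∂(E.measure ψ) := by
          rw [integral_add ((hint ψ m).const_mul 2) ((hint ψ n).const_mul 2),
            integral_const_mul, integral_const_mul]
      _ < ε ^ 2 := by linarith [hN m hm, hN n hn]
  choose g hg using fun ψ => cauchySeq_tendsto_of_complete (hcauchy ψ)
  let T : 𝓗 →L[ℂ] 𝓗 := continuousLinearMapOfTendsto (fun n => E.simpleIntegral (s n))
    (f := g) (tendsto_pi_nhds.mpr hg)
  refine ⟨T, fun ψ => ?_⟩
  have h1 : Tendsto (fun n => inner ℂ ψ (E.simpleIntegral (s n) ψ)) atTop (𝓝 (inner ℂ ψ (T ψ))) :=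
    (tendsto_const_nhds (x := ψ)).inner (hg ψ)
  have h2 : Tendsto (fun n => inner ℂ ψ (E.simpleIntegral (s n) ψ)) atTop
      (𝓝 (∫ l, f l ∂(E.measure ψ))) := by
    simp only [inner_simpleIntegral]
    exact tendsto_integral_of_dominated_convergence (fun _ => 2 * C)
      (fun n => (s n).measurable.aestronglyMeasurable) (integrable_const _)
      (fun n => Eventually.of_forall (hsb n)) (Eventually.of_forall hst)
  exact tendsto_nhds_unique h1 h2

theorem exists_evolution (E : SpectralMeasure 𝓗) (t : ℝ) :
    ∃ T : 𝓗 →L[ℂ] 𝓗, ∀ ψ, inner ℂ ψ (T ψ)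
      = ∫ l : ℝ, Complex.exp (-Complex.I * (l : ℂ) * (t : ℂ)) ∂(E.measure ψ) :=
  E.exists_integral _ (by fun_prop) ⟨1, fun l => by simp [Complex.norm_exp]⟩

/-- The evolution operator `e^{-iHt} = ∫ e^{-ilt} dE(l)` of the Hamiltonian `H = ∫ l dE(l)`: the
bounded operator whose quadratic form is `ψ ↦ ∫ e^{-ilt} d⟨ψ, E(l)ψ⟩` (unique by polarization). -/
def evolution (E : SpectralMeasure 𝓗) (t : ℝ) : 𝓗 →L[ℂ] 𝓗 :=
  Classical.choose (E.exists_evolution t)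

theorem inner_evolution (E : SpectralMeasure 𝓗) (t : ℝ) (ψ : 𝓗) :
    inner ℂ ψ (E.evolution t ψ)
      = ∫ l : ℝ, Complex.exp (-Complex.I * (l : ℂ) * (t : ℂ)) ∂(E.measure ψ) :=
  Classical.choose_spec (E.exists_evolution t) ψ

/-- `E` is the spectral measure of the (possibly unbounded) operator `H`, i.e. `H = ∫ l dE(l)`,
with domain the vectors for which `∫ l² d⟨ψ, E(l)ψ⟩` is finite.  By the spectral theorem every
self-adjoint operator has exactly one spectral measure. -/
structure IsResolutionOf (E : SpectralMeasure 𝓗) (H : 𝓗 →ₗ.[ℂ] 𝓗) : Prop where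
  mem_domain_iff : ∀ ψ : 𝓗, ψ ∈ H.domain ↔ Integrable (fun l : ℝ => l ^ 2) (E.measure ψ)
  inner_apply : ∀ ψ : H.domain,
    inner ℂ (ψ : 𝓗) (H ψ) = ((∫ l : ℝ, l ∂(E.measure (ψ : 𝓗)) : ℝ) : ℂ)

end SpectralMeasure

section Trace

variable (𝓗 : Type*) [NormedAddCommGroup 𝓗] [InnerProductSpace ℂ 𝓗] [CompleteSpace 𝓗]

/-- A Hilbert basis of the Hilbert space `𝓗`. -/
def basisSet : Set 𝓗 := Classical.choose (exists_hilbertBasis ℂ 𝓗)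

/-- A Hilbert basis of the Hilbert space `𝓗`. -/
def basis : HilbertBasis (basisSet 𝓗) ℂ 𝓗 :=
  Classical.choose (Classical.choose_spec (exists_hilbertBasis ℂ 𝓗))

variable {𝓗}

/-- The trace of an operator; it is only used for trace-class operators, for which it does not
depend on the basis. -/
def trace (T : 𝓗 →L[ℂ] 𝓗) : ℂ := ∑' i, inner ℂ (basis 𝓗 i) (T (basis 𝓗 i))

/-- Density operators: positive (trace-class) operators of trace one. -/
structure IsDensityOperator (ρ : 𝓗 →L[ℂ] 𝓗) : Prop where
  isPositive : ρ.IsPositive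
  hasSum_one : HasSum (fun i => inner ℂ (basis 𝓗 i) (ρ (basis 𝓗 i))) 1

end Trace

/-- A quantum realization `(𝓗, ρ, H, M)` of a timeline with measurement settings `X` and outcomes
`A`: a state `ρ`, a self-adjoint Hamiltonian `H ≥ 0` (together with its spectral measure), and
for each setting `x` a POVM `(M_{a|x})_a`. -/
structure Realization (𝓗 : Type*) [NormedAddCommGroup 𝓗] [InnerProductSpace ℂ 𝓗]
    [CompleteSpace 𝓗] (X A : Type*) [Fintype A] where
  state : 𝓗 →L[ℂ] 𝓗
  isDensityOperator_state : IsDensityOperator state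
  ham : 𝓗 →ₗ.[ℂ] 𝓗
  isSelfAdjoint_ham : IsSelfAdjoint ham
  ham_nonneg : ∀ ψ : ham.domain, 0 ≤ (inner ℂ (ψ : 𝓗) (ham ψ)).re
  spec : SpectralMeasure 𝓗
  isResolutionOf_spec : spec.IsResolutionOf ham
  meas : X → A → 𝓗 →L[ℂ] 𝓗
  isPositive_meas : ∀ x a, (meas x a).IsPositive
  sum_meas : ∀ x, ∑ a, meas x a = 1

namespace Realization

variable {𝓗 : Type*} [NormedAddCommGroup 𝓗] [InnerProductSpace ℂ 𝓗] [CompleteSpace 𝓗]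
  {X A : Type*} [Fintype A]

/-- `P(a|x,t) = tr(e^{-iHt} ρ e^{iHt} M_{a|x})`. -/
def timeline (R : Realization 𝓗 X A) : X → A → ℝ → ℝ := fun x a t =>
  (trace (R.spec.evolution t * R.state * R.spec.evolution (-t) * R.meas x a)).re

/-- The probability `tr(ρ 1_{[E⁺,∞)}(H))` that the state has energy above or equal to `E⁺`. -/
def highEnergyProb (R : Realization 𝓗 X A) (Eplus : ℝ) : ℝ :=
  (trace (R.state * R.spec.proj (Set.Ici Eplus))).re

end Realization

/-- The set `S(E⁺; ε)` of timelines that admit a realization under the soft energy support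
constraint: the energy is above or equal to `E⁺` with probability at most `ε`. -/
def softSupportSet (X A : Type*) [Fintype A] (Eplus ε : ℝ) : Set (X → A → ℝ → ℝ) :=
  {P | ∃ (𝓗 : Type) (_ : NormedAddCommGroup 𝓗) (_ : InnerProductSpace ℂ 𝓗) (_ : CompleteSpace 𝓗)
    (R : Realization 𝓗 X A), R.highEnergyProb Eplus ≤ ε ∧ P = R.timeline}

/-- The set `S(E⁺; ε, t)` of datasets obtained from `S(E⁺; ε)` at measurement times
`t = (t₁, …, t_N)`. -/
def softSupportDatasets (X A : Type*) [Fintype A] (Eplus ε : ℝ) {N : ℕ} (t : Fin N → ℝ) :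
    Set (X → A → Fin N → ℝ) :=
  {Q | ∃ P ∈ softSupportSet X A Eplus ε, Q = fun x a j => P x a (t j)}

/-- The timeline `P` fits the noisy dataset with measurement times `t`, probability estimates `Q`
and error bars `δ`. -/
def Fits {X A : Type*} [Fintype A] {N : ℕ} (t : Fin N → ℝ) (Q : X → A → Fin N → ℝ)
    (δ : X → Fin N → ℝ) (P : X → A → ℝ → ℝ) : Prop :=
  ∀ x j, ∑ a, |P x a (t j) - Q x a j| ≤ δ x j

/-- The dataset `P̃(0|t₁) = 1`, `P̃(0|t₂) = 0` (hence `P̃(1|t₁) = 0`, `P̃(1|t₂) = 1`), with a single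
measurement setting and two outcomes. -/
def flipDataset : Fin 1 → Fin 2 → Fin 2 → ℝ := fun _ => ![![1, 0], ![0, 1]]

/-- The dataset with three measurement times in which outcome `0` has probabilities `1, 0, 0`. -/
def extendedDataset : Fin 1 → Fin 2 → Fin 3 → ℝ := fun _ => ![![1, 0, 0], ![0, 1, 1]]

/-- The noisy dataset `(P̃, δ)` at times `0`, `Δ`, with the same error bar `δ` at both times. -/
def FitsFlip (Δ δ : ℝ) (P : Fin 1 → Fin 2 → ℝ → ℝ) : Prop :=
  Fits ![0, Δ] flipDataset (fun _ _ => δ) P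

/-- `τ_m = 2Δ + Δ / (2m + 1)`. -/
def tau (Δ : ℝ) (m : ℕ) : ℝ := 2 * Δ + Δ / (2 * (m : ℝ) + 1)

/-- The projector `|φ⟩⟨φ|` onto a unit vector `φ` of `ℂ²`. -/
def ketbra (φ : EuclideanSpace ℂ (Fin 2)) :
    EuclideanSpace ℂ (Fin 2) →L[ℂ] EuclideanSpace ℂ (Fin 2) :=
  InnerProductSpace.rankOne ℂ φ φ

/-- `|+⟩ = (|0⟩ + |1⟩)/√2`. -/
def ketPlus : EuclideanSpace ℂ (Fin 2) := !₂[((1 / √2 : ℝ) : ℂ), ((1 / √2 : ℝ) : ℂ)]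

/-- `|1⟩`. -/
def ketOne : EuclideanSpace ℂ (Fin 2) := !₂[0, 1]

/-- The Hamiltonian `H_m = ((2m+1)π/Δ) |1⟩⟨1|` on `ℂ²`, as an everywhere defined operator. -/
def qubitHam (Δ : ℝ) (m : ℕ) : EuclideanSpace ℂ (Fin 2) →ₗ.[ℂ] EuclideanSpace ℂ (Fin 2) :=
  LinearMap.toPMap
    (((((2 * (m : ℝ) + 1) * Real.pi / Δ : ℝ) : ℂ) • ketbra ketOne :
      EuclideanSpace ℂ (Fin 2) →L[ℂ] EuclideanSpace ℂ (Fin 2)) :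
      EuclideanSpace ℂ (Fin 2) →ₗ[ℂ] EuclideanSpace ℂ (Fin 2)) ⊤

end TimedMeasurement

end

open TimedMeasurement

/-! Write U_t for the evolution and x = E⁺Δ. Fitting the flip makes the states at times 0 and Δ
almost perfectly distinguishable, so Re tr(U_Δ ρ), the mean of cos(lΔ) over the energy distribution,
is at most 2√δ. At least half of that distribution lies in [0, E⁺), where cos(lΔ) ≈ 1 when x is
small; the other half must then compensate with cos(lΔ) ≈ -1. In both cases 2lΔ is close to a
multiple of 2π, so the state nearly returns at time 2Δ.

The quantitative core is the scalar inequality `one_sub_cos_two_mul_le`. Integrated over the energy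
distribution, it gives 1 - Re tr(U_{2Δ} ρ) ≤ 8√δ + 4x²: the energy constraint cancels its constant
-4. This controls the mean squared distance between the states at times 0 and 2Δ, and Cauchy-Schwarz
turns it into a bound on P(0|0) - P(0|2Δ) (`one_sub_timeline_two_mul_le`). Mixed states are treated
as ensembles of vectors √ρ b_j (`exists_ensemble`), which turns every trace into a convergent sum
over j.

The recurrence is unstable in time. A qubit with energies 0 and ω = (2m+1)π/Δ, half of its weight on
each, has amplitude (1 + e^{-iωt})/2. This vanishes at Δ, and again at τ_m, half a period after 2Δ.
So the dataset (1,0,0) is attained at times τ_m → 2Δ but stays away from the closure at 2Δ, which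
rules out Hausdorff continuity. -/

namespace TimedMeasurement

/-! ### Quadratic forms, Parseval sums and square roots of positive operators. -/

section General

variable {𝓗 : Type*} [NormedAddCommGroup 𝓗] [InnerProductSpace ℂ 𝓗]

/-- Convergence of the quadratic forms implies convergence of the sesquilinear forms. -/
theorem tendsto_inner_of_tendsto_inner_self {ι : Type*} {l : Filter ι} {S : ι → 𝓗 →L[ℂ] 𝓗}
    {T : 𝓗 →L[ℂ] 𝓗} (h : ∀ x, Tendsto (fun n => inner ℂ x (S n x)) l (𝓝 (inner ℂ x (T x))))
    (x y : 𝓗) : Tendsto (fun n => inner ℂ (S n y) x) l (𝓝 (inner ℂ (T y) x)) := by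
  have h' : ∀ x, Tendsto (fun n => inner ℂ ((S n : 𝓗 →ₗ[ℂ] 𝓗) x) x) l
      (𝓝 (inner ℂ ((T : 𝓗 →ₗ[ℂ] 𝓗) x) x)) := fun x => by
    simpa [inner_conj_symm, Function.comp_def] using
      (Complex.continuous_conj.tendsto _).comp (h x)
  have key := ((((h' (x + y)).sub (h' (x - y))).add
    ((h' (x + Complex.I • y)).const_mul Complex.I)).sub
    ((h' (x - Complex.I • y)).const_mul Complex.I)).div_const 4
  simp only [← inner_map_polarization] at key
  exact key

/-- Two bounded operators with the same quadratic form are equal. -/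
theorem eq_of_inner_self_eq {S T : 𝓗 →L[ℂ] 𝓗} (h : ∀ x, inner ℂ x (S x) = inner ℂ x (T x)) :
    S = T := by
  apply ContinuousLinearMap.coe_injective
  rw [← ext_inner_map]
  intro x
  rw [← inner_conj_symm, ← inner_conj_symm (_ : 𝓗) x]
  exact congrArg _ (h x)

theorem hasSum_norm_inner_sq {ι : Type*} (b : HilbertBasis ι ℂ 𝓗) (x : 𝓗) :
    HasSum (fun i => ‖inner ℂ (b i) x‖ ^ 2) (‖x‖ ^ 2) := by
  have h := b.hasSum_inner_mul_inner x x
  rw [inner_self_eq_norm_sq_to_K] at h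
  have h' : ∀ i, inner ℂ x (b i) * inner ℂ (b i) x = ((‖inner ℂ (b i) x‖ ^ 2 : ℝ) : ℂ) := by
    intro i
    rw [← inner_conj_symm, mul_comm, Complex.mul_conj, Complex.normSq_eq_norm_sq]
  simp only [h'] at h
  rw [← Complex.hasSum_ofReal, Complex.ofReal_pow]
  exact h

theorem summable_norm_inner_sq {ι κ : Type*} (b : HilbertBasis ι ℂ 𝓗) {x : κ → 𝓗}
    (hx : Summable fun j => ‖x j‖ ^ 2) :
    Summable fun p : κ × ι => ‖inner ℂ (b p.2) (x p.1)‖ ^ 2 := by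
  refine (summable_prod_of_nonneg fun p => by positivity).2
    ⟨fun j => (hasSum_norm_inner_sq b (x j)).summable, ?_⟩
  simpa only [(hasSum_norm_inner_sq b _).tsum_eq] using hx

theorem summable_norm_apply_sq {κ : Type*} {x : κ → 𝓗} (hx : Summable fun j => ‖x j‖ ^ 2)
    (W : 𝓗 →L[ℂ] 𝓗) : Summable fun j => ‖W (x j)‖ ^ 2 := by
  refine Summable.of_nonneg_of_le (fun j => by positivity) (fun j => ?_) (hx.mul_left (‖W‖ ^ 2))
  rw [← mul_pow]
  gcongr
  exact W.le_opNorm _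

/-- Fubini for an absolutely summable double family: both iterated sums equal the total. This is
what lets the trace be evaluated in the other order in `hasSum_trace`. -/
theorem hasSum_tsum_of_summable_prod {ι κ : Type*} {F : ι × κ → ℂ} {g : ι → ℂ} {h : κ → ℂ}
    (hF : Summable F) (hg : ∀ i, HasSum (fun j => F (i, j)) (g i))
    (hh : ∀ j, HasSum (fun i => F (i, j)) (h j)) : HasSum g (∑' j, h j) := by
  have hF' : HasSum (fun p : κ × ι => F p.swap) (∑' p, F p) :=
    (Equiv.prodComm κ ι).hasSum_iff.2 hF.hasSum
  have h2 : HasSum h (∑' p, F p) := HasSum.prod_fiberwise (f := fun p : κ × ι => F p.swap) hF' hh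
  rw [h2.tsum_eq]
  exact hF.hasSum.prod_fiberwise hg

variable [CompleteSpace 𝓗]

open ContinuousLinearMap in
/-- The square root of a positive operator: `T = s²` with `s` self-adjoint. -/
theorem exists_sqrt {T : 𝓗 →L[ℂ] 𝓗} (hT : T.IsPositive) :
    ∃ s : 𝓗 →L[ℂ] 𝓗, (∀ x y, inner ℂ (s x) y = inner ℂ x (s y)) ∧ s * s = T := by
  have h0 : 0 ≤ T := (nonneg_iff_isPositive T).2 hT
  have hs : IsSelfAdjoint (CFC.sqrt T) :=
    ((nonneg_iff_isPositive _).1 (CFC.sqrt_nonneg T)).isSelfAdjoint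
  exact ⟨CFC.sqrt T, fun x y => by
    rw [← adjoint_inner_left, hs.adjoint_eq], CFC.sqrt_mul_sqrt_self T h0⟩

/-- Cauchy-Schwarz inequality for sums. -/
theorem exists_hasSum_mul_le {ι : Type*} {f g : ι → ℝ} {a b : ℝ}
    (hf : ∀ i, 0 ≤ f i) (hg : ∀ i, 0 ≤ g i)
    (ha : HasSum (fun i => f i ^ 2) a) (hb : HasSum (fun i => g i ^ 2) b) :
    ∃ c, HasSum (fun i => f i * g i) c ∧ c ≤ √a * √b := by
  have h2 : Real.HolderConjugate 2 2 := Real.HolderConjugate.two_two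
  have hfs : Summable fun i => f i ^ (2 : ℝ) := by simpa using ha.summable
  have hgs : Summable fun i => g i ^ (2 : ℝ) := by simpa using hb.summable
  have key := Real.inner_le_Lp_mul_Lq_tsum_of_nonneg h2 hf hg hfs hgs
  have hs := Real.summable_mul_of_Lp_Lq_of_nonneg h2 hf hg hfs hgs
  simp only [Real.rpow_two, ha.tsum_eq, hb.tsum_eq, ← Real.sqrt_eq_rpow] at key
  exact ⟨_, hs.hasSum, key⟩

end General

/-! ### Properties of the evolution and positivity of the spectrum. -/

namespace SpectralMeasure

variable {𝓗 : Type*} [NormedAddCommGroup 𝓗] [InnerProductSpace ℂ 𝓗] [CompleteSpace 𝓗]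

theorem measureReal_univ (E : SpectralMeasure 𝓗) (ψ : 𝓗) :
    (E.measure ψ).real Set.univ = ‖ψ‖ ^ 2 := by
  rw [E.measureReal_apply ψ MeasurableSet.univ, E.proj_univ]; rfl

/-- `T` is known only through its quadratic form, so simple functions s_n → f give only weak
convergence of their integrals to `T`. Their norms converge to (∫ ‖f‖²)^{1/2}, and weak lower
semicontinuity of the norm gives the bound. Contractivity is all that the recurrence estimate needs
of the evolution; unitarity and the group law are not required there. -/
theorem norm_le_of_inner_eq_integral (E : SpectralMeasure 𝓗) {f : ℝ → ℂ} (hf : Measurable f)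
    (hb : ∀ l, ‖f l‖ ≤ 1) {T : 𝓗 →L[ℂ] 𝓗}
    (hT : ∀ ψ, inner ℂ ψ (T ψ) = ∫ l, f l ∂(E.measure ψ)) (ψ : 𝓗) : ‖T ψ‖ ≤ ‖ψ‖ := by
  let s : ℕ → SimpleFunc ℝ ℂ := SimpleFunc.approxOn f hf Set.univ 0 (Set.mem_univ _)
  have hsb : ∀ n l, ‖s n l‖ ≤ 2 := fun n l => by
    have := SimpleFunc.norm_approxOn_zero_le hf (Set.mem_univ (0 : ℂ)) l n
    linarith [hb l]
  have hst : ∀ l, Tendsto (fun n => s n l) atTop (𝓝 (f l)) := fun l =>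
    SimpleFunc.tendsto_approxOn hf (Set.mem_univ _) (by simp)
  have hweak : ∀ φ, Tendsto (fun n => inner ℂ φ (E.simpleIntegral (s n) φ)) atTop
      (𝓝 (inner ℂ φ (T φ))) := fun φ => by
    simp only [inner_simpleIntegral, hT]
    exact tendsto_integral_of_dominated_convergence (fun _ => 2)
      (fun n => (s n).measurable.aestronglyMeasurable) (integrable_const _)
      (fun n => Eventually.of_forall (hsb n)) (Eventually.of_forall hst)
  have hsq : Tendsto (fun n => ‖E.simpleIntegral (s n) ψ‖ ^ 2) atTop
      (𝓝 (∫ l, ‖f l‖ ^ 2 ∂(E.measure ψ))) := by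
    simp only [norm_simpleIntegral_sq]
    refine tendsto_integral_of_dominated_convergence (fun _ => 2 ^ 2)
      (fun n => ((s n).measurable.norm.pow_const 2).aestronglyMeasurable) (integrable_const _)
      (fun n => Eventually.of_forall fun l => ?_)
      (Eventually.of_forall fun l => (hst l).norm.pow 2)
    rw [Real.norm_of_nonneg (by positivity)]
    gcongr
    exact hsb n l
  have hle : ∫ l, ‖f l‖ ^ 2 ∂(E.measure ψ) ≤ ‖ψ‖ ^ 2 := by
    rw [← E.measureReal_univ ψ]
    calc ∫ l, ‖f l‖ ^ 2 ∂(E.measure ψ) ≤ ∫ _, (1 : ℝ) ∂(E.measure ψ) :=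
          integral_mono_of_nonneg (Eventually.of_forall fun l => by positivity)
            (integrable_const _) (Eventually.of_forall fun l => pow_le_one₀ (norm_nonneg _) (hb l))
      _ = _ := by simp
  have hnorm := hsq.sqrt
  simp only [Real.sqrt_sq (norm_nonneg _)] at hnorm
  -- Testing the weak limit against `T ψ` itself gives ‖Tψ‖² ≤ (∫ ‖f‖²)^{1/2} ‖Tψ‖; one factor ‖Tψ‖
  -- is cancelled at the end.
  have h1 := tendsto_inner_of_tendsto_inner_self hweak (T ψ) ψ
  have h2 : ‖inner ℂ (T ψ) (T ψ)‖ ≤ √(∫ l, ‖f l‖ ^ 2 ∂(E.measure ψ)) * ‖T ψ‖ :=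
    le_of_tendsto_of_tendsto' h1.norm (hnorm.mul_const _) fun n => norm_inner_le_norm _ _
  rw [inner_self_eq_norm_sq_to_K, norm_pow, RCLike.norm_ofReal, abs_of_nonneg (norm_nonneg _)] at h2
  have h3 : √(∫ l, ‖f l‖ ^ 2 ∂(E.measure ψ)) ≤ ‖ψ‖ := by
    rw [← Real.sqrt_sq (norm_nonneg ψ)]; exact Real.sqrt_le_sqrt hle
  rcases (norm_nonneg (T ψ)).eq_or_lt with h | h
  · rw [← h]; exact norm_nonneg _
  · nlinarith

theorem norm_evolution_le (E : SpectralMeasure 𝓗) (t : ℝ) (ψ : 𝓗) :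
    ‖E.evolution t ψ‖ ≤ ‖ψ‖ :=
  E.norm_le_of_inner_eq_integral (by fun_prop) (fun l => by simp [Complex.norm_exp])
    (E.inner_evolution t) ψ

theorem evolution_zero (E : SpectralMeasure 𝓗) : E.evolution 0 = 1 := by
  refine eq_of_inner_self_eq fun ψ => ?_
  rw [inner_evolution]
  simp [E.measureReal_univ, inner_self_eq_norm_sq_to_K]

theorem inner_evolution_neg (E : SpectralMeasure 𝓗) (t : ℝ) (x y : 𝓗) :
    inner ℂ x (E.evolution (-t) y) = inner ℂ (E.evolution t x) y := by
  have h : E.evolution (-t) = ContinuousLinearMap.adjoint (E.evolution t) := by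
    refine eq_of_inner_self_eq fun ψ => ?_
    rw [ContinuousLinearMap.adjoint_inner_right, ← inner_conj_symm (E.evolution t ψ),
      inner_evolution, inner_evolution, ← integral_conj]
    refine integral_congr_ae (Eventually.of_forall fun l => ?_)
    simp [← Complex.exp_conj]
  rw [h, ContinuousLinearMap.adjoint_inner_right]

theorem re_inner_evolution (E : SpectralMeasure 𝓗) (t : ℝ) (ψ : 𝓗) :
    (inner ℂ ψ (E.evolution t ψ)).re = ∫ l, Real.cos (l * t) ∂(E.measure ψ) := by
  have hi : Integrable (fun l : ℝ => Complex.exp (-Complex.I * (l : ℂ) * (t : ℂ)))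
      (E.measure ψ) :=
    Integrable.of_bound (C := 1) (by fun_prop)
      (Eventually.of_forall fun l => by simp [Complex.norm_exp])
  rw [inner_evolution]
  have := integral_re hi
  simp only [RCLike.re_to_complex] at this
  rw [← this]
  refine integral_congr_ae (Eventually.of_forall fun l => ?_)
  simp [Complex.exp_re]

theorem proj_proj (E : SpectralMeasure 𝓗) {A B : Set ℝ} (hA : MeasurableSet A)
    (hB : MeasurableSet B) (ψ : 𝓗) : E.proj A (E.proj B ψ) = E.proj (A ∩ B) ψ := by
  rw [E.proj_inter A B hA hB]; rfl

theorem measure_proj (E : SpectralMeasure 𝓗) {B : Set ℝ} (hB : MeasurableSet B) (ψ : 𝓗) :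
    E.measure (E.proj B ψ) = (E.measure ψ).restrict B := by
  ext A hA
  rw [Measure.restrict_apply hA, E.measure_apply _ hA, E.measure_apply _ (hA.inter hB),
    E.proj_proj hA hB]

/-- Cut `ψ` down to the bounded window B = [-n, 0). The vector E(B)ψ lies in the domain, and its
mean energy is the integral over B of a strictly negative function, yet it must be nonnegative.
Hence B has measure zero, and these windows exhaust the negative half-line. -/
theorem IsResolutionOf.measure_Iio_eq_zero {E : SpectralMeasure 𝓗} {H : 𝓗 →ₗ.[ℂ] 𝓗}
    (hE : E.IsResolutionOf H) (hH : ∀ ψ : H.domain, 0 ≤ (inner ℂ (ψ : 𝓗) (H ψ)).re) (ψ : 𝓗) :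
    E.measure ψ (Set.Iio 0) = 0 := by
  have hn : ∀ n : ℕ, E.measure ψ (Set.Ico (-(n : ℝ)) 0) = 0 := by
    intro n
    set B := Set.Ico (-(n : ℝ)) 0 with hBdef
    have hB : MeasurableSet B := measurableSet_Ico
    have hae : ∀ᵐ l ∂((E.measure ψ).restrict B), l ∈ B := ae_restrict_mem hB
    have hint2 : Integrable (fun l : ℝ => l ^ 2) (E.measure (E.proj B ψ)) := by
      rw [E.measure_proj hB]
      refine Integrable.of_bound (C := (n : ℝ) ^ 2) (by fun_prop) ?_
      filter_upwards [hae] with l hl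
      rw [Real.norm_of_nonneg (by positivity)]
      nlinarith [hl.1, hl.2]
    have hint : Integrable (fun l : ℝ => -l) ((E.measure ψ).restrict B) := by
      refine Integrable.of_bound (C := (n : ℝ)) (by fun_prop) ?_
      filter_upwards [hae] with l hl
      rw [norm_neg, Real.norm_eq_abs, abs_le]
      exact ⟨hl.1, by linarith [hl.1, hl.2]⟩
    have hdom := (hE.mem_domain_iff _).2 hint2
    have h0 := hH ⟨_, hdom⟩
    rw [hE.inner_apply ⟨_, hdom⟩, Complex.ofReal_re] at h0
    simp only [E.measure_proj hB] at h0
    have hnn : 0 ≤ᵐ[(E.measure ψ).restrict B] fun l : ℝ => -l := by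
      filter_upwards [hae] with l hl
      simpa using hl.2.le
    have hz : ∫ l, -l ∂((E.measure ψ).restrict B) = 0 := by
      refine le_antisymm ?_ (integral_nonneg_of_ae hnn)
      rw [integral_neg]; linarith
    have hzero := (integral_eq_zero_iff_of_nonneg_ae hnn hint).1 hz
    have hfalse : ∀ᵐ l ∂((E.measure ψ).restrict B), False := by
      filter_upwards [hae, hzero] with l hl hl0
      have : l = 0 := by simpa using hl0
      exact absurd hl.2 (by rw [this]; exact lt_irrefl _)
    have := ae_eq_bot.1 (eventually_false_iff_eq_bot.1 hfalse)
    rwa [Measure.restrict_eq_zero] at this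
  have hU : Set.Iio (0 : ℝ) ⊆ ⋃ n : ℕ, Set.Ico (-(n : ℝ)) 0 := fun l hl => by
    obtain ⟨n, hn⟩ := exists_nat_ge (-l)
    exact Set.mem_iUnion.2 ⟨n, by linarith, hl⟩
  exact measure_mono_null hU (measure_iUnion_null hn)

end SpectralMeasure

/-! ### Cyclicity of the trace. -/

section Trace

variable {𝓗 : Type*} [NormedAddCommGroup 𝓗] [InnerProductSpace ℂ 𝓗] [CompleteSpace 𝓗]

open ContinuousLinearMap

/-- Cyclicity of the trace for a product `V s² T` with `s` a Hilbert-Schmidt operator. -/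
theorem hasSum_trace {s : 𝓗 →L[ℂ] 𝓗} (hs : ∀ x y, inner ℂ (s x) y = inner ℂ x (s y))
    (hsum : Summable fun i => ‖s (basis 𝓗 i)‖ ^ 2) (V T : 𝓗 →L[ℂ] 𝓗) :
    HasSum (fun j => inner ℂ (s (basis 𝓗 j)) (T (V (s (basis 𝓗 j)))))
      (trace (V * (s * s) * T)) := by
  rw [trace]
  generalize basis 𝓗 = b at hsum ⊢
  -- The first index labels the vector s b_j, the second a resolution of the identity inserted
  -- between T and V. Summing over the second gives ⟨s b_j, T V s b_j⟩; summing over the first,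
  -- after moving s across, gives the diagonal entries of V s² T. Summability follows from |uv| ≤ u²
  -- + v² and the Hilbert-Schmidt property of s.
  let F : basisSet 𝓗 × basisSet 𝓗 → ℂ := fun p =>
    inner ℂ (adjoint T (s (b p.1))) (b p.2) * inner ℂ (b p.2) (V (s (b p.1)))
  have hF : Summable F := by
    refine Summable.of_norm_bounded
      ((summable_norm_inner_sq b (summable_norm_apply_sq hsum (adjoint T))).add
        (summable_norm_inner_sq b (summable_norm_apply_sq hsum V))) fun p => ?_
    rw [norm_mul, norm_inner_symm]
    set u := ‖inner ℂ (b p.2) (adjoint T (s (b p.1)))‖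
    set v := ‖inner ℂ (b p.2) (V (s (b p.1)))‖
    nlinarith [sq_nonneg (u - v), sq_nonneg u, sq_nonneg v]
  refine hasSum_tsum_of_summable_prod hF (fun j => ?_) fun i => ?_
  · have h := b.hasSum_inner_mul_inner (adjoint T (s (b j))) (V (s (b j)))
    rw [adjoint_inner_left] at h
    exact h
  · have h := b.hasSum_inner_mul_inner (s (adjoint V (b i))) (s (T (b i)))
    rw [hs, adjoint_inner_left] at h
    have hswap : ∀ j, F (j, i) = inner ℂ (s (adjoint V (b i))) (b j)
        * inner ℂ (b j) (s (T (b i))) := by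
      intro j
      simp only [F]
      rw [hs, adjoint_inner_left, adjoint_inner_left, hs, mul_comm]
    simp only [hswap]
    exact h

/-- Trace against a pure state. -/
theorem trace_rankOne (φ : 𝓗) (V T : 𝓗 →L[ℂ] 𝓗) :
    trace (V * InnerProductSpace.rankOne ℂ φ φ * T) = inner ℂ φ (T (V φ)) := by
  have h := (basis 𝓗).hasSum_inner_mul_inner (adjoint T φ) (V φ)
  rw [adjoint_inner_left] at h
  rw [trace, ← h.tsum_eq]
  refine tsum_congr fun i => ?_
  simp [adjoint_inner_left]

end Trace

end TimedMeasurement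

/-! ### The recurrence bound at time 2Δ. -/

namespace TimedMeasurement

/-- With c = cos(lΔ) the left side is 2 - 2c². For l ≥ E⁺ the claim reduces to 2(1 + c)² + 4(E⁺Δ)² ≥
0. For 0 ≤ l < E⁺ put d = 1 - c: it reduces to 8d - 2d² ≤ 4(E⁺Δ)², which follows from d ≤ (lΔ)²/2.
The coefficients -4 and 8 are matched to the threshold ½, so that they cancel when high energies
have probability ½. -/
theorem one_sub_cos_two_mul_le {Eplus Δ l : ℝ} (hΔ : 0 < Δ) (hl : 0 ≤ l) :
    1 - Real.cos (l * (2 * Δ)) ≤ 4 * Real.cos (l * Δ) + (-4 + 4 * (Eplus * Δ) ^ 2)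
      + 8 * (Set.Ici Eplus).indicator 1 l := by
  have h2 : Real.cos (l * (2 * Δ)) = 2 * Real.cos (l * Δ) ^ 2 - 1 := by
    rw [← Real.cos_two_mul]; ring_nf
  rw [h2]
  by_cases h : l ∈ Set.Ici Eplus
  · rw [Set.indicator_of_mem h, Pi.one_apply]
    nlinarith [sq_nonneg (1 + Real.cos (l * Δ)), sq_nonneg (Eplus * Δ)]
  · rw [Set.indicator_of_notMem h]
    have hlt : l < Eplus := not_le.1 h
    have hc := Real.one_sub_sq_div_two_le_cos (x := l * Δ)
    have hx : (l * Δ) ^ 2 ≤ (Eplus * Δ) ^ 2 := by gcongr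
    nlinarith [sq_nonneg (1 - Real.cos (l * Δ)), Real.cos_le_one (l * Δ)]

namespace SpectralMeasure

variable {𝓗 : Type*} [NormedAddCommGroup 𝓗] [InnerProductSpace ℂ 𝓗] [CompleteSpace 𝓗]

theorem sq_norm_sub_re_inner_evolution_two_mul_le (E : SpectralMeasure 𝓗) {Eplus Δ : ℝ}
    (hΔ : 0 < Δ) (ψ : 𝓗) (hpos : E.measure ψ (Set.Iio 0) = 0) :
    ‖ψ‖ ^ 2 - (inner ℂ ψ (E.evolution (2 * Δ) ψ)).re
      ≤ 4 * (inner ℂ ψ (E.evolution Δ ψ)).re + (-4 + 4 * (Eplus * Δ) ^ 2) * ‖ψ‖ ^ 2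
        + 8 * ‖E.proj (Set.Ici Eplus) ψ‖ ^ 2 := by
  have hcos : ∀ t : ℝ, Integrable (fun l : ℝ => Real.cos (l * t)) (E.measure ψ) := fun t =>
    Integrable.of_bound (C := 1) (by fun_prop)
      (Eventually.of_forall fun l => Real.abs_cos_le_one _)
  have hind : Integrable ((Set.Ici Eplus).indicator (1 : ℝ → ℝ)) (E.measure ψ) :=
    (integrable_const (1 : ℝ)).indicator measurableSet_Ici
  have hae : ∀ᵐ l ∂(E.measure ψ), 0 ≤ l := by
    rw [ae_iff]
    convert hpos using 2
    ext l; simp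
  have hmono := integral_mono_ae ((integrable_const (1 : ℝ)).sub (hcos (2 * Δ)))
    ((((hcos Δ).const_mul 4).add (integrable_const (-4 + 4 * (Eplus * Δ) ^ 2))).add
      (hind.const_mul 8)) (hae.mono fun l hl => one_sub_cos_two_mul_le (Eplus := Eplus) hΔ hl)
  simp only [Pi.sub_apply, Pi.add_apply] at hmono
  rw [integral_sub (integrable_const _) (hcos _)] at hmono
  erw [integral_add (((hcos Δ).const_mul 4).add (integrable_const _)) (hind.const_mul 8),
    integral_add ((hcos Δ).const_mul 4) (integrable_const _)] at hmono
  rw [integral_const_mul, integral_const_mul, integral_indicator_one measurableSet_Ici,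
    integral_const, integral_const, ← E.re_inner_evolution, ← E.re_inner_evolution,
    E.measureReal_apply ψ measurableSet_Ici, E.measureReal_univ, smul_eq_mul, smul_eq_mul]
    at hmono
  linarith

end SpectralMeasure

namespace Realization

variable {𝓗 : Type*} [NormedAddCommGroup 𝓗] [InnerProductSpace ℂ 𝓗] [CompleteSpace 𝓗]
  {X A : Type*} [Fintype A]

/-- Decomposition of the state of a realization into a family of (unnormalized) pure states. -/
theorem exists_ensemble (R : Realization 𝓗 X A) :
    ∃ ψ : basisSet 𝓗 → 𝓗, HasSum (fun j => ‖ψ j‖ ^ 2) 1 ∧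
      ∀ V T : 𝓗 →L[ℂ] 𝓗,
        HasSum (fun j => inner ℂ (ψ j) (T (V (ψ j)))) (trace (V * R.state * T)) := by
  obtain ⟨s, hs, hss⟩ := exists_sqrt R.isDensityOperator_state.isPositive
  have h1 : HasSum (fun j => ‖s (basis 𝓗 j)‖ ^ 2) 1 := by
    rw [← Complex.hasSum_ofReal, Complex.ofReal_one]
    convert R.isDensityOperator_state.hasSum_one using 2 with j
    rw [← hss, mul_apply_eq_comp, ← hs, inner_self_eq_norm_sq_to_K]
    norm_cast
  exact ⟨fun j => s (basis 𝓗 j), h1, fun V T => hss ▸ hasSum_trace hs h1.summable V T⟩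

/-- Since U_{-t} is the adjoint of U_t, cyclicity turns the trace into a sum of squared norms. In
this form positivity and Cauchy-Schwarz over the ensemble are immediate. -/
theorem hasSum_timeline {R : Realization 𝓗 X A} {ψ : basisSet 𝓗 → 𝓗}
    (hψ : ∀ V T : 𝓗 →L[ℂ] 𝓗,
      HasSum (fun j => inner ℂ (ψ j) (T (V (ψ j)))) (trace (V * R.state * T)))
    {x : X} {a : A} {s : 𝓗 →L[ℂ] 𝓗} (hs : ∀ u v, inner ℂ (s u) v = inner ℂ u (s v))
    (hsa : s * s = R.meas x a) (t : ℝ) :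
    HasSum (fun j => ‖s (R.spec.evolution t (ψ j))‖ ^ 2) (R.timeline x a t) := by
  have h := Complex.hasSum_re (hψ (R.spec.evolution t) (R.spec.evolution (-t) * R.meas x a))
  rw [← mul_assoc] at h
  refine HasSum.congr_fun h fun j => ?_
  rw [mul_apply_eq_comp, SpectralMeasure.inner_evolution_neg, ← hsa,
    mul_apply_eq_comp, ← hs, inner_self_eq_norm_sq_to_K]
  norm_cast

theorem timeline_nonneg (R : Realization 𝓗 X A) (x : X) (a : A) (t : ℝ) :
    0 ≤ R.timeline x a t := by
  obtain ⟨ψ, -, hψ⟩ := R.exists_ensemble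
  obtain ⟨s, hs, hss⟩ := exists_sqrt (R.isPositive_meas x a)
  exact (hasSum_timeline hψ hs hss t).nonneg fun j => by positivity

theorem one_sub_timeline_two_mul_le (R : Realization 𝓗 (Fin 1) (Fin 2)) {Eplus Δ δ : ℝ}
    (hΔ : 0 < Δ) (hE : R.highEnergyProb Eplus ≤ 1 / 2) (hfit : FitsFlip Δ δ R.timeline) :
    1 - R.timeline 0 0 (2 * Δ) ≤ δ + 2 * √(16 * √δ + 8 * (Eplus * Δ) ^ 2) := by
  obtain ⟨ψ, h1, hψ⟩ := R.exists_ensemble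
  -- s and r are the square roots of M₀ and M₁; s² + r² = 1 makes both of them contractions.
  obtain ⟨s, hs, hss⟩ := exists_sqrt (R.isPositive_meas 0 0)
  obtain ⟨r, hr, hrr⟩ := exists_sqrt (R.isPositive_meas 0 1)
  have hsr : ∀ v, s (s v) + r (r v) = v := fun v => by
    have h := R.sum_meas 0
    rw [Fin.sum_univ_two, ← hss, ← hrr] at h
    exact congrArg (fun T : 𝓗 →L[ℂ] 𝓗 => T v) h
  have hnorm : ∀ v, ‖s v‖ ^ 2 + ‖r v‖ ^ 2 = ‖v‖ ^ 2 := fun v => by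
    have h : (inner ℂ v (s (s v) + r (r v))) = inner ℂ v v := by rw [hsr]
    rw [inner_add_right, ← hs, ← hr] at h
    simp only [inner_self_eq_norm_sq_to_K] at h
    exact_mod_cast h
  have hsle : ∀ v, ‖s v‖ ≤ ‖v‖ := fun v =>
    abs_le_of_sq_le_sq' (by linarith [hnorm v, sq_nonneg ‖r v‖]) (norm_nonneg _) |>.2
  have hrle : ∀ v, ‖r v‖ ≤ ‖v‖ := fun v =>
    abs_le_of_sq_le_sq' (by linarith [hnorm v, sq_nonneg ‖s v‖]) (norm_nonneg _) |>.2
  have hU := fun t j => R.spec.norm_evolution_le t (ψ j)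
  have hf0 := hfit 0 0
  have hfΔ := hfit 0 1
  simp only [Fin.sum_univ_two, flipDataset, Matrix.cons_val_zero, Matrix.cons_val_one,
    Matrix.cons_val_fin_one, sub_zero] at hf0 hfΔ
  have hP00 : 1 - R.timeline 0 0 0 ≤ δ := by
    have := neg_abs_le (R.timeline 0 0 0 - 1)
    linarith [abs_nonneg (R.timeline 0 1 0)]
  have hP10 : R.timeline 0 1 0 ≤ δ := by
    linarith [abs_nonneg (R.timeline 0 0 0 - 1), le_abs_self (R.timeline 0 1 0)]
  have hP0Δ : R.timeline 0 0 Δ ≤ δ := by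
    linarith [abs_nonneg (R.timeline 0 1 Δ - 1), le_abs_self (R.timeline 0 0 Δ)]
  have hev : ∀ t, HasSum (fun j => (inner ℂ (ψ j) (R.spec.evolution t (ψ j))).re)
      (trace (R.spec.evolution t * R.state)).re := fun t => by
    have h := Complex.hasSum_re (hψ (R.spec.evolution t) 1)
    rwa [mul_one] at h
  -- the states at times `0` and `Δ` are almost perfectly distinguished
  have hre : (trace (R.spec.evolution Δ * R.state)).re ≤ 2 * √δ := by
    have hs0 := hasSum_timeline hψ hs hss Δ
    have hr0 := hasSum_timeline hψ hr hrr 0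
    simp only [SpectralMeasure.evolution_zero, one_apply_eq_self] at hr0
    obtain ⟨a, ha, hale⟩ := exists_hasSum_mul_le (fun _ => norm_nonneg _)
      (fun _ => norm_nonneg _) h1 hs0
    obtain ⟨b, hb, hble⟩ := exists_hasSum_mul_le (fun _ => norm_nonneg _)
      (fun _ => norm_nonneg _) hr0 h1
    -- Insert s² + r² = 1 into ⟨ψ_j, Uψ_j⟩ and bound it by ‖ψ_j‖‖sUψ_j‖ + ‖rψ_j‖‖ψ_j‖.
    -- Cauchy-Schwarz over j gives √P(0|Δ) + √P(1|0), each term at most √δ.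
    have hle := hasSum_le (fun j => ?_) (hev Δ) (ha.add hb)
    · rw [Real.sqrt_one] at hale hble
      linarith [Real.sqrt_le_sqrt hP0Δ, Real.sqrt_le_sqrt hP10]
    · set u := R.spec.evolution Δ (ψ j) with hu
      have huψ : ‖u‖ ≤ ‖ψ j‖ := hU Δ j
      have h : inner ℂ (ψ j) u = inner ℂ (s (ψ j)) (s u) + inner ℂ (r (ψ j)) (r u) := by
        rw [hs, hr, ← inner_add_right, hsr]
      rw [h, Complex.add_re]
      gcongr
      · exact (re_inner_le_norm (𝕜 := ℂ) (s (ψ j)) (s u)).trans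
          (mul_le_mul_of_nonneg_right (hsle _) (norm_nonneg _))
      · exact (re_inner_le_norm (𝕜 := ℂ) (r (ψ j)) (r u)).trans
          (mul_le_mul_of_nonneg_left ((hrle _).trans huψ) (norm_nonneg _))
  have hq : HasSum (fun j => ‖R.spec.proj (Set.Ici Eplus) (ψ j)‖ ^ 2)
      (R.highEnergyProb Eplus) := by
    have h := Complex.hasSum_re (hψ 1 (R.spec.proj (Set.Ici Eplus)))
    rw [one_mul] at h
    refine HasSum.congr_fun h fun j => ?_
    rw [one_apply_eq_self, R.spec.inner_proj measurableSet_Ici, Complex.ofReal_re]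
  have hre2 : 1 - (trace (R.spec.evolution (2 * Δ) * R.state)).re
      ≤ 8 * √δ + 4 * (Eplus * Δ) ^ 2 := by
    -- After summation the high-energy term is at most 8 · ½ and absorbs the constant -4; the
    -- remaining cosine term is at most 4 · 2√δ.
    have h := hasSum_le (fun j => R.spec.sq_norm_sub_re_inner_evolution_two_mul_le
      (Eplus := Eplus) hΔ (ψ j) (R.isResolutionOf_spec.measure_Iio_eq_zero R.ham_nonneg (ψ j)))
      (h1.sub (hev (2 * Δ)))
      ((((hev Δ).mul_left 4).add (h1.mul_left (-4 + 4 * (Eplus * Δ) ^ 2))).add (hq.mul_left 8))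
    linarith
  set D : ℝ := 2 * (1 - (trace (R.spec.evolution (2 * Δ) * R.state)).re)
  have hD : HasSum (fun j => ‖ψ j‖ ^ 2 + ‖ψ j‖ ^ 2
      - 2 * (inner ℂ (ψ j) (R.spec.evolution (2 * Δ) (ψ j))).re) D := by
    rw [show D = 1 + 1 - 2 * (trace (R.spec.evolution (2 * Δ) * R.state)).re by
      simp only [D]; ring]
    exact (h1.add h1).sub ((hev (2 * Δ)).mul_left 2)
  -- Expand the square and use ‖Uψ_j‖ ≤ ‖ψ_j‖.
  have hdist : ∀ j, ‖ψ j - R.spec.evolution (2 * Δ) (ψ j)‖ ^ 2 ≤ ‖ψ j‖ ^ 2 + ‖ψ j‖ ^ 2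
      - 2 * (inner ℂ (ψ j) (R.spec.evolution (2 * Δ) (ψ j))).re := fun j => by
    rw [@norm_sub_sq ℂ, RCLike.re_to_complex]
    nlinarith [hU (2 * Δ) j, norm_nonneg (R.spec.evolution (2 * Δ) (ψ j))]
  have hds := Summable.of_nonneg_of_le (fun j => by positivity) hdist hD.summable
  have hdD := hasSum_le hdist hds.hasSum hD
  obtain ⟨c, hc, hcle⟩ := exists_hasSum_mul_le (fun _ => norm_nonneg _)
    (fun _ => norm_nonneg _) hds.hasSum h1
  have hs0 := hasSum_timeline hψ hs hss 0
  simp only [SpectralMeasure.evolution_zero, one_apply_eq_self] at hs0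
  -- Factor ‖sψ_j‖² - ‖sUψ_j‖² as a difference of squares: one factor is at most the displacement
  -- ‖ψ_j - Uψ_j‖, the other at most 2‖ψ_j‖. Cauchy-Schwarz then gives P(0|0) - P(0|2Δ) ≤ 2√D.
  have hdiff := hasSum_le (fun j => ?_) (hs0.sub (hasSum_timeline hψ hs hss (2 * Δ)))
    (hc.mul_left 2)
  · rw [Real.sqrt_one, mul_one] at hcle
    have := Real.sqrt_le_sqrt (hdD.trans
      (show D ≤ 16 * √δ + 8 * (Eplus * Δ) ^ 2 by simp only [D]; linarith))
    linarith
  · set u := R.spec.evolution (2 * Δ) (ψ j) with hu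
    have huψ : ‖u‖ ≤ ‖ψ j‖ := hU (2 * Δ) j
    have h3 : ‖s (ψ j)‖ - ‖s u‖ ≤ ‖ψ j - u‖ := by
      refine (norm_sub_norm_le _ _).trans ?_
      rw [← map_sub]
      exact hsle _
    have h4 : ‖s (ψ j)‖ + ‖s u‖ ≤ 2 * ‖ψ j‖ := by linarith [hsle (ψ j), hsle u]
    calc ‖s (ψ j)‖ ^ 2 - ‖s u‖ ^ 2 = (‖s (ψ j)‖ - ‖s u‖) * (‖s (ψ j)‖ + ‖s u‖) := by ring
      _ ≤ ‖ψ j - u‖ * (2 * ‖ψ j‖) := by gcongr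
      _ = 2 * (‖ψ j - u‖ * ‖ψ j‖) := by ring

/-- The square-root form of the bound. -/
theorem one_sub_timeline_two_mul_le_sqrt (R : Realization 𝓗 (Fin 1) (Fin 2)) {Eplus Δ δ : ℝ}
    (hΔ : 0 < Δ) (hδ : 0 ≤ δ) (hE : R.highEnergyProb Eplus ≤ 1 / 2)
    (hfit : FitsFlip Δ δ R.timeline) :
    1 - R.timeline 0 0 (2 * Δ) ≤ √(130 * √δ + 64 * (Eplus * Δ) ^ 2) := by
  have h := R.one_sub_timeline_two_mul_le hΔ hE hfit
  have h0 := R.timeline_nonneg 0 0 (2 * Δ)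
  have hs := Real.sq_sqrt hδ
  have hsn := Real.sqrt_nonneg δ
  rcases le_or_gt (1 - R.timeline 0 0 (2 * Δ)) 0 with hneg | hpos
  · exact hneg.trans (Real.sqrt_nonneg _)
  · apply Real.le_sqrt_of_sq_le
    -- For δ ≤ 1, (δ + 2y)² ≤ 2δ² + 8y² and δ² ≤ √δ give the constants 130 = 2 + 8·16 and 64 = 8·8.
    -- For δ > 1 the right side exceeds 1 while the left side is at most 1.
    rcases le_or_gt δ 1 with hδ1 | hδ1
    · set y := √(16 * √δ + 8 * (Eplus * Δ) ^ 2)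
      have hy : y ^ 2 = 16 * √δ + 8 * (Eplus * Δ) ^ 2 := Real.sq_sqrt (by positivity)
      have hs1 : √δ ≤ 1 := Real.sqrt_le_one.2 hδ1
      have hδs : δ ^ 2 ≤ √δ := by
        nlinarith
      calc (1 - R.timeline 0 0 (2 * Δ)) ^ 2 ≤ (δ + 2 * y) ^ 2 := by gcongr
        _ ≤ 2 * δ ^ 2 + 8 * y ^ 2 := by nlinarith [sq_nonneg (δ - 2 * y)]
        _ ≤ _ := by rw [hy]; linarith
    · have hs1 : 1 ≤ √δ := Real.one_le_sqrt.2 hδ1.le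
      nlinarith [sq_nonneg (Eplus * Δ)]

end Realization

end TimedMeasurement

namespace TimedMeasurement

noncomputable section

/-! ### Spectral calculus of diagonal operators in finite dimension. -/

section Diagonal

variable {ι : Type*} [Fintype ι] [DecidableEq ι]

/-- The diagonal operator with entries `c`. -/
def diagOp (c : ι → ℂ) : EuclideanSpace ℂ ι →L[ℂ] EuclideanSpace ℂ ι :=
  Matrix.toEuclideanCLM (n := ι) (𝕜 := ℂ) (Matrix.diagonal c)

@[simp]
theorem diagOp_apply (c : ι → ℂ) (ψ : EuclideanSpace ℂ ι) (i : ι) :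
    diagOp c ψ i = c i * ψ i := by
  simp [diagOp, Matrix.mulVec_diagonal]

theorem diagOp_mul (c d : ι → ℂ) : diagOp c * diagOp d = diagOp (c * d) := by
  rw [diagOp, diagOp, ← map_mul, Matrix.diagonal_mul_diagonal]; rfl

theorem star_diagOp (c : ι → ℂ) : star (diagOp c) = diagOp (star c) := by
  rw [diagOp, ← map_star, Matrix.star_eq_conjTranspose, Matrix.diagonal_conjTranspose]; rfl

theorem diagOp_one : diagOp (1 : ι → ℂ) = 1 := by
  ext ψ i; simp

theorem norm_diagOp_apply_sq (c : ι → ℂ) (ψ : EuclideanSpace ℂ ι) :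
    ‖diagOp c ψ‖ ^ 2 = ∑ i, ‖c i‖ ^ 2 * ‖ψ i‖ ^ 2 := by
  simp [EuclideanSpace.norm_sq_eq, mul_pow]

theorem inner_diagOp_apply (c : ι → ℂ) (ψ : EuclideanSpace ℂ ι) :
    inner ℂ ψ (diagOp c ψ) = ∑ i, (‖ψ i‖ : ℂ) ^ 2 * c i := by
  rw [PiLp.inner_apply]
  refine Finset.sum_congr rfl fun i _ => ?_
  rw [diagOp_apply, RCLike.inner_apply, mul_assoc, Complex.mul_conj, Complex.normSq_eq_norm_sq,
    mul_comm]
  norm_cast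

/-- The operator applied to a fixed vector is linear in its entries, hence continuous in finite
dimension. -/
theorem hasSum_diagOp {κ : Type*} {c : κ → ι → ℂ} {d : ι → ℂ} (h : HasSum c d)
    (ψ : EuclideanSpace ℂ ι) : HasSum (fun k => diagOp (c k) ψ) (diagOp d ψ) := by
  let L : (ι → ℂ) →ₗ[ℂ] EuclideanSpace ℂ ι :=
    { toFun := fun c => diagOp c ψ
      map_add' := fun c d => by ext i; simp [add_mul]
      map_smul' := fun a c => by ext i; simp [mul_assoc] }
  exact h.mapL L.toContinuousLinearMap

theorem hasSum_indicator_one_iUnion {α : Type*} {A : ℕ → Set α}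
    (hA : Pairwise (Function.onFun Disjoint A)) (x : α) :
    HasSum (fun n => (A n).indicator (1 : α → ℂ) x) ((⋃ n, A n).indicator 1 x) := by
  by_cases hx : x ∈ ⋃ n, A n
  · obtain ⟨k, hk⟩ := Set.mem_iUnion.1 hx
    rw [Set.indicator_of_mem hx, ← Set.indicator_of_mem hk (1 : α → ℂ)]
    refine hasSum_single k fun n hn => Set.indicator_of_notMem (fun h => ?_) _
    exact Set.disjoint_left.1 (hA hn) h hk
  · rw [Set.indicator_of_notMem hx]
    convert hasSum_zero with n
    exact Set.indicator_of_notMem (fun h => hx (Set.mem_iUnion.2 ⟨n, h⟩)) _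

/-- The spectral measure of the diagonal operator with entries `h`. -/
def diagSpec (h : ι → ℝ) : SpectralMeasure (EuclideanSpace ℂ ι) where
  proj A := diagOp fun i => A.indicator 1 (h i)
  isStarProjection A _ := by
    refine ⟨?_, ?_⟩
    · rw [IsIdempotentElem, diagOp_mul]
      congr 1; ext i
      by_cases hi : h i ∈ A <;> simp [hi]
    · rw [IsSelfAdjoint, star_diagOp]
      congr 1; ext i
      by_cases hi : h i ∈ A <;> simp [hi]
  proj_univ := by
    rw [← diagOp_one]
    congr 1; ext i; simp
  proj_inter A B _ _ := by
    rw [diagOp_mul]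
    congr 1; ext i
    rw [Set.inter_indicator_one]; rfl
  hasSum_iUnion A _ hd ψ :=
    hasSum_diagOp (Pi.hasSum.2 fun i => hasSum_indicator_one_iUnion hd (h i)) ψ

theorem measure_diagSpec (h : ι → ℝ) (ψ : EuclideanSpace ℂ ι) :
    (diagSpec h).measure ψ = ∑ i, ENNReal.ofReal (‖ψ i‖ ^ 2) • Measure.dirac (h i) := by
  ext A hA
  rw [SpectralMeasure.measure_apply _ _ hA, Measure.finsetSum_apply]
  simp only [diagSpec, norm_diagOp_apply_sq]
  rw [ENNReal.ofReal_sum_of_nonneg fun i _ => by positivity]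
  refine Finset.sum_congr rfl fun i _ => ?_
  by_cases hi : h i ∈ A <;> simp [hi, hA]

/-- The energy distribution is a finite sum of point masses, so no condition on f is needed; in
particular the operator domain is the whole space. -/
theorem integrable_diagSpec {E : Type*} [NormedAddCommGroup E] (h : ι → ℝ)
    (ψ : EuclideanSpace ℂ ι) (f : ℝ → E) : Integrable f ((diagSpec h).measure ψ) := by
  rw [measure_diagSpec, integrable_finsetSum_measure]
  exact fun i _ => (integrable_dirac (by simp)).smul_measure ENNReal.ofReal_ne_top

theorem integral_diagSpec {E : Type*} [NormedAddCommGroup E] [NormedSpace ℝ E] [CompleteSpace E]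
    (h : ι → ℝ) (ψ : EuclideanSpace ℂ ι) (f : ℝ → E) :
    ∫ l, f l ∂((diagSpec h).measure ψ) = ∑ i, ‖ψ i‖ ^ 2 • f (h i) := by
  rw [measure_diagSpec, integral_finsetSum_measure
    fun i _ => (integrable_dirac (by simp)).smul_measure ENNReal.ofReal_ne_top]
  refine Finset.sum_congr rfl fun i _ => ?_
  rw [integral_smul_measure, integral_dirac, ENNReal.toReal_ofReal (by positivity)]

/-- The evolution is obtained by choice from its quadratic form, so comparing quadratic forms is the
way to identify it. -/
theorem evolution_diagSpec (h : ι → ℝ) (t : ℝ) :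
    (diagSpec h).evolution t
      = diagOp fun i => Complex.exp (-Complex.I * (h i : ℂ) * (t : ℂ)) := by
  refine eq_of_inner_self_eq fun ψ => ?_
  rw [SpectralMeasure.inner_evolution, integral_diagSpec, inner_diagOp_apply]
  simp

theorem isResolutionOf_diagSpec (h : ι → ℝ) :
    (diagSpec h).IsResolutionOf (LinearMap.toPMap
      (diagOp fun i => (h i : ℂ) : EuclideanSpace ℂ ι →ₗ[ℂ] EuclideanSpace ℂ ι) ⊤) where
  mem_domain_iff ψ := ⟨fun _ => integrable_diagSpec h ψ _, fun _ => Submodule.mem_top⟩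
  inner_apply ψ := by
    change inner ℂ (ψ : EuclideanSpace ℂ ι) (diagOp (fun i => (h i : ℂ)) ψ) = _
    rw [integral_diagSpec, inner_diagOp_apply]
    simp

theorem isSelfAdjoint_toPMap_diagOp (h : ι → ℝ) :
    IsSelfAdjoint (LinearMap.toPMap
      (diagOp fun i => (h i : ℂ) : EuclideanSpace ℂ ι →ₗ[ℂ] EuclideanSpace ℂ ι) ⊤) := by
  rw [LinearPMap.isSelfAdjoint_def,
    ContinuousLinearMap.toPMap_adjoint_eq_adjoint_toPMap_of_dense _ (by simp),
    ← ContinuousLinearMap.star_eq_adjoint, star_diagOp]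
  congr 3
  ext i
  simp

end Diagonal

/-! ### The qubit realizations. -/

theorem norm_ketPlus : ‖ketPlus‖ = 1 := by
  rw [← sq_eq_sq₀ (norm_nonneg _) zero_le_one, EuclideanSpace.norm_sq_eq, Fin.sum_univ_two]
  simp [ketPlus]
  norm_num

theorem qubitHam_eq (Δ : ℝ) (m : ℕ) :
    qubitHam Δ m = LinearMap.toPMap
      (diagOp fun i => ((![0, (2 * (m : ℝ) + 1) * Real.pi / Δ] i : ℝ) : ℂ) :
        EuclideanSpace ℂ (Fin 2) →ₗ[ℂ] EuclideanSpace ℂ (Fin 2)) ⊤ := by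
  rw [qubitHam]
  congr 2
  ext ψ i
  fin_cases i <;> simp [ketbra, ketOne, PiLp.inner_apply]

theorem isDensityOperator_rankOne {𝓗 : Type*} [NormedAddCommGroup 𝓗] [InnerProductSpace ℂ 𝓗]
    [CompleteSpace 𝓗] {φ : 𝓗} (hφ : ‖φ‖ = 1) :
    IsDensityOperator (InnerProductSpace.rankOne ℂ φ φ) where
  isPositive := InnerProductSpace.isPositive_rankOne_self φ
  hasSum_one := by
    have h := (basis 𝓗).hasSum_inner_mul_inner φ φ
    rw [inner_self_eq_norm_sq_to_K, hφ] at h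
    simpa using h

/-- The qubit realization whose Hamiltonian has energies `0` and `(2m+1)π/Δ`. -/
def qubitRealization (Δ : ℝ) (hΔ : 0 < Δ) (m : ℕ) :
    Realization (EuclideanSpace ℂ (Fin 2)) (Fin 1) (Fin 2) where
  state := ketbra ketPlus
  isDensityOperator_state := isDensityOperator_rankOne norm_ketPlus
  ham := qubitHam Δ m
  isSelfAdjoint_ham := by
    rw [qubitHam_eq]; exact isSelfAdjoint_toPMap_diagOp _
  ham_nonneg := by
    rw [qubitHam_eq]
    intro ψ
    rw [(isResolutionOf_diagSpec _).inner_apply, Complex.ofReal_re, integral_diagSpec,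
      Fin.sum_univ_two]
    simp only [Matrix.cons_val_zero, Matrix.cons_val_one, Matrix.cons_val_fin_one, smul_eq_mul]
    positivity
  spec := diagSpec ![0, (2 * (m : ℝ) + 1) * Real.pi / Δ]
  isResolutionOf_spec := by
    rw [qubitHam_eq]; exact isResolutionOf_diagSpec _
  meas _ := ![ketbra ketPlus, 1 - ketbra ketPlus]
  isPositive_meas _ a := by
    have h : IsStarProjection (ketbra ketPlus) :=
      InnerProductSpace.isStarProjection_rankOne_self norm_ketPlus
    fin_cases a
    · exact ContinuousLinearMap.IsPositive.of_isStarProjection h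
    · exact ContinuousLinearMap.IsPositive.of_isStarProjection h.one_sub
  sum_meas _ := by simp [Fin.sum_univ_two]

/-- Half of the weight of |+⟩ sits at energy 0, which is below E⁺; only the other half can reach the
threshold, whatever the size of (2m+1)π/Δ. -/
theorem highEnergyProb_qubitRealization_le {Eplus Δ : ℝ} (hE : 0 < Eplus) (hΔ : 0 < Δ) (m : ℕ) :
    (qubitRealization Δ hΔ m).highEnergyProb Eplus ≤ 1 / 2 := by
  have h := trace_rankOne ketPlus 1 ((qubitRealization Δ hΔ m).spec.proj (Set.Ici Eplus))
  rw [one_mul, one_apply_eq_self] at h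
  have h' : (qubitRealization Δ hΔ m).highEnergyProb Eplus =
      (inner ℂ ketPlus ((qubitRealization Δ hΔ m).spec.proj (Set.Ici Eplus) ketPlus)).re :=
    congrArg Complex.re h
  rw [h', SpectralMeasure.inner_proj _ measurableSet_Ici, Complex.ofReal_re]
  simp only [qubitRealization, diagSpec, norm_diagOp_apply_sq, Fin.sum_univ_two]
  simp only [Matrix.cons_val_zero, Matrix.cons_val_one, Matrix.cons_val_fin_one]
  rw [Set.indicator_of_notMem (by simpa using hE)]
  by_cases h1 : (2 * (m : ℝ) + 1) * Real.pi / Δ ∈ Set.Ici Eplus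
  · rw [Set.indicator_of_mem h1]
    simp [ketPlus]
  · rw [Set.indicator_of_notMem h1]
    simp

theorem inner_ketPlus_evolution {Δ : ℝ} (hΔ : 0 < Δ) (m : ℕ) (t : ℝ) :
    inner ℂ ketPlus ((qubitRealization Δ hΔ m).spec.evolution t ketPlus) =
      (1 + Complex.exp (-Complex.I * (((2 * (m : ℝ) + 1) * Real.pi / Δ * t : ℝ) : ℂ))) / 2 := by
  simp only [qubitRealization, evolution_diagSpec, inner_diagOp_apply, Fin.sum_univ_two]
  have h2 : ((√2 : ℝ) : ℂ) ^ 2 = 2 := by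
    rw [← Complex.ofReal_pow, Real.sq_sqrt (by norm_num)]; norm_num
  simp [ketPlus, abs_of_nonneg (Real.sqrt_nonneg 2), inv_pow, h2]
  ring_nf

theorem timeline_qubitRealization_zero {Δ : ℝ} (hΔ : 0 < Δ) (m : ℕ) (t : ℝ) :
    (qubitRealization Δ hΔ m).timeline 0 0 t =
      ‖inner ℂ ketPlus ((qubitRealization Δ hΔ m).spec.evolution t ketPlus)‖ ^ 2 := by
  set R := qubitRealization Δ hΔ m
  have h := trace_rankOne ketPlus (R.spec.evolution t) (R.spec.evolution (-t) * ketbra ketPlus)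
  rw [← mul_assoc, mul_apply_eq_comp, SpectralMeasure.inner_evolution_neg, ketbra,
    InnerProductSpace.rankOne_apply, inner_smul_right, ← inner_conj_symm _ ketPlus,
    Complex.mul_conj, Complex.normSq_eq_norm_sq] at h
  exact congrArg Complex.re h

theorem timeline_qubitRealization_one {Δ : ℝ} (hΔ : 0 < Δ) (m : ℕ) (t : ℝ) :
    (qubitRealization Δ hΔ m).timeline 0 1 t =
      1 - (qubitRealization Δ hΔ m).timeline 0 0 t := by
  rw [timeline_qubitRealization_zero]
  -- Normalization of the two outcomes needs the norm to be preserved exactly, not merely not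
  -- increased; here it is read off from the diagonal phases.
  have hU : ‖(qubitRealization Δ hΔ m).spec.evolution t ketPlus‖ ^ 2 = 1 := by
    simp only [qubitRealization, evolution_diagSpec, norm_diagOp_apply_sq, Fin.sum_univ_two]
    simp [ketPlus, Complex.norm_exp]
    norm_num
  set R := qubitRealization Δ hΔ m
  have h := trace_rankOne ketPlus (R.spec.evolution t)
    (R.spec.evolution (-t) * (1 - ketbra ketPlus))
  rw [← mul_assoc, mul_apply_eq_comp, SpectralMeasure.inner_evolution_neg,
    sub_apply, inner_sub_right, one_apply_eq_self, inner_self_eq_norm_sq_to_K, ketbra,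
    InnerProductSpace.rankOne_apply, inner_smul_right, ← inner_conj_symm _ ketPlus,
    Complex.mul_conj, Complex.normSq_eq_norm_sq] at h
  have h' := congrArg Complex.re h
  refine h'.trans ?_
  rw [← hU, Complex.sub_re, Complex.ofReal_re]
  norm_cast

theorem timeline_qubitRealization_at_zero {Δ : ℝ} (hΔ : 0 < Δ) (m : ℕ) :
    (qubitRealization Δ hΔ m).timeline 0 0 0 = 1 := by
  rw [timeline_qubitRealization_zero, inner_ketPlus_evolution]
  norm_num

/-- At odd multiples of π the two energy levels are exactly out of phase and the amplitude (1 +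
e^{-iωt})/2 vanishes. -/
theorem timeline_qubitRealization_eq_zero {Δ : ℝ} (hΔ : 0 < Δ) (m : ℕ) {t : ℝ} {k : ℕ}
    (ht : (2 * (m : ℝ) + 1) * Real.pi / Δ * t = Real.pi + k * (2 * Real.pi)) :
    (qubitRealization Δ hΔ m).timeline 0 0 t = 0 := by
  rw [timeline_qubitRealization_zero, inner_ketPlus_evolution, ht]
  have : Complex.exp (-Complex.I * ((Real.pi + k * (2 * Real.pi) : ℝ) : ℂ)) = -1 := by
    have h : -Complex.I * ((Real.pi + k * (2 * Real.pi) : ℝ) : ℂ)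
        = -(Real.pi * Complex.I + k * (2 * Real.pi * Complex.I)) := by
      push_cast; ring
    rw [h, Complex.exp_neg, Complex.exp_add, Complex.exp_nat_mul_two_pi_mul_I, Complex.exp_pi_mul_I]
    norm_num
  rw [this]
  simp

theorem timeline_qubitRealization_Delta {Δ : ℝ} (hΔ : 0 < Δ) (m : ℕ) :
    (qubitRealization Δ hΔ m).timeline 0 0 Δ = 0 := by
  refine timeline_qubitRealization_eq_zero hΔ m (k := m) ?_
  field_simp
  ring

theorem timeline_qubitRealization_tau {Δ : ℝ} (hΔ : 0 < Δ) (m : ℕ) :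
    (qubitRealization Δ hΔ m).timeline 0 0 (tau Δ m) = 0 := by
  -- With ω = (2m+1)π/Δ, the time 2Δ contributes (2m+1)·2π, and the extra Δ/(2m+1) contributes
  -- exactly π.
  refine timeline_qubitRealization_eq_zero hΔ m (k := 2 * m + 1) ?_
  have : (2 * (m : ℝ) + 1) ≠ 0 := by positivity
  rw [tau]
  push_cast
  field_simp
  ring

theorem fitsFlip_qubitRealization {Δ : ℝ} (hΔ : 0 < Δ) (m : ℕ) :
    FitsFlip Δ 0 (qubitRealization Δ hΔ m).timeline := by
  intro x j
  fin_cases x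
  fin_cases j
  · simp [flipDataset, timeline_qubitRealization_one, timeline_qubitRealization_at_zero]
  · simp [flipDataset, timeline_qubitRealization_one, timeline_qubitRealization_Delta]

theorem timeline_qubitRealization_mem {Eplus Δ : ℝ} (hE : 0 < Eplus) (hΔ : 0 < Δ) (m : ℕ) :
    (qubitRealization Δ hΔ m).timeline ∈ softSupportSet (Fin 1) (Fin 2) Eplus (1 / 2) :=
  ⟨_, _, _, _, qubitRealization Δ hΔ m, highEnergyProb_qubitRealization_le hE hΔ m, rfl⟩

theorem extendedDataset_mem {Eplus Δ : ℝ} (hE : 0 < Eplus) (hΔ : 0 < Δ) (m : ℕ) :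
    extendedDataset ∈ softSupportDatasets (Fin 1) (Fin 2) Eplus (1 / 2) ![0, Δ, tau Δ m] := by
  refine ⟨_, timeline_qubitRealization_mem hE hΔ m, ?_⟩
  funext x a j
  fin_cases x
  fin_cases a <;> fin_cases j <;>
  simp [extendedDataset, timeline_qubitRealization_one, timeline_qubitRealization_at_zero,
    timeline_qubitRealization_Delta, timeline_qubitRealization_tau]

theorem tendsto_tau (Δ : ℝ) : Tendsto (tau Δ) atTop (𝓝 (2 * Δ)) := by
  have h : Tendsto (fun m : ℕ => 2 * (m : ℝ) + 1) atTop atTop :=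
    tendsto_atTop_add_const_right _ _
      (tendsto_natCast_atTop_atTop.const_mul_atTop (by norm_num))
  have h' := (tendsto_const_nhds (x := 2 * Δ)).add (h.const_div_atTop Δ)
  rwa [add_zero] at h'

end

end TimedMeasurement

/-! ### Exclusion of the dataset at 2Δ and discontinuity. -/

namespace TimedMeasurement

theorem FitsFlip.mono {Δ δ δ' : ℝ} {P : Fin 1 → Fin 2 → ℝ → ℝ} (h : FitsFlip Δ δ P)
    (hδ : δ ≤ δ') : FitsFlip Δ δ' P := fun x j => (h x j).trans hδ

theorem one_sub_le_sqrt_of_mem_softSupportSet {Eplus Δ δ : ℝ} (hΔ : 0 < Δ) (hδ : 0 ≤ δ)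
    {P : Fin 1 → Fin 2 → ℝ → ℝ} (hP : P ∈ softSupportSet (Fin 1) (Fin 2) Eplus (1 / 2))
    (hfit : FitsFlip Δ δ P) :
    1 - P 0 0 (2 * Δ) ≤ √(130 * √δ + 64 * (Eplus * Δ) ^ 2) := by
  obtain ⟨𝓗, _, _, _, R, hR, rfl⟩ := hP
  exact R.one_sub_timeline_two_mul_le_sqrt hΔ hδ hR hfit

theorem isLeast_timeline_tau {Eplus Δ δ : ℝ} (hE : 0 < Eplus) (hΔ : 0 < Δ) (hδ : 0 ≤ δ) (m : ℕ) :
    IsLeast {p : ℝ | ∃ P ∈ softSupportSet (Fin 1) (Fin 2) Eplus (1 / 2),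
      FitsFlip Δ δ P ∧ p = P 0 0 (tau Δ m)} 0 := by
  refine ⟨⟨_, timeline_qubitRealization_mem hE hΔ m, (fitsFlip_qubitRealization hΔ m).mono hδ,
    (timeline_qubitRealization_tau hΔ m).symm⟩, ?_⟩
  rintro p ⟨P, ⟨𝓗, _, _, _, R, -, rfl⟩, -, rfl⟩
  exact R.timeline_nonneg _ _ _

theorem extendedDataset_notMem_closure {Eplus Δ : ℝ} (hE : 0 < Eplus) (hΔ : 0 < Δ)
    (h : Eplus * Δ ≤ 1 / 32) :
    extendedDataset ∉
      closure (softSupportDatasets (Fin 1) (Fin 2) Eplus (1 / 2) ![0, Δ, 2 * Δ]) := by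
  intro hmem
  -- Summing the error over two outcomes gives δ = (1/1040)², so 130√δ = 1/8. With E⁺Δ ≤ 1/32 the
  -- other term is at most 1/16, and 1/8 + 1/16 ≤ 1/4 forces P(0|2Δ) ≥ 1/2.
  have hε : (0 : ℝ) < 1 / 2 * (1 / 1040) ^ 2 := by norm_num
  obtain ⟨_, ⟨P, hP, rfl⟩, hd⟩ := Metric.mem_closure_iff.1 hmem _ hε
  have hdist : ∀ a j, |P 0 a (![0, Δ, 2 * Δ] j) - extendedDataset 0 a j|
      ≤ 1 / 2 * (1 / 1040) ^ 2 := by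
    intro a j
    rw [← Real.dist_eq, dist_comm]
    exact ((dist_le_pi_dist (extendedDataset 0 a) _ j).trans
      ((dist_le_pi_dist (extendedDataset 0) _ a).trans
        (dist_le_pi_dist extendedDataset _ 0))).trans hd.le
  have hfit : FitsFlip Δ ((1 / 1040) ^ 2) P := by
    intro x j
    fin_cases x
    rw [Fin.sum_univ_two]
    fin_cases j
    · have h0 := hdist 0 0
      have h1 := hdist 1 0
      simp [extendedDataset, flipDataset] at h0 h1 ⊢
      linarith
    · have h0 := hdist 0 1
      have h1 := hdist 1 1
      simp [extendedDataset, flipDataset] at h0 h1 ⊢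
      linarith
  have hbound := one_sub_le_sqrt_of_mem_softSupportSet hΔ (by positivity) hP hfit
  have hP2 : P 0 0 (2 * Δ) ≤ 1 / 2 * (1 / 1040) ^ 2 := by
    have := hdist 0 2
    simp only [extendedDataset, Matrix.cons_val_zero, Matrix.cons_val, sub_zero] at this
    exact (le_abs_self _).trans this
  have hsq : (Eplus * Δ) ^ 2 ≤ (1 / 32) ^ 2 := by gcongr
  have hle : √(130 * √((1 / 1040 : ℝ) ^ 2) + 64 * (Eplus * Δ) ^ 2) ≤ 1 / 2 := by
    rw [Real.sqrt_sq (by norm_num), Real.sqrt_le_left (by norm_num)]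
    linarith
  linarith

theorem not_tendsto_hausdorffEDist {Eplus Δ : ℝ} (hE : 0 < Eplus) (hΔ : 0 < Δ)
    (h : Eplus * Δ ≤ 1 / 32) :
    ¬ Tendsto (fun t : Fin 3 → ℝ => Metric.hausdorffEDist
        (softSupportDatasets (Fin 1) (Fin 2) Eplus (1 / 2) t)
        (softSupportDatasets (Fin 1) (Fin 2) Eplus (1 / 2) ![0, Δ, 2 * Δ]))
      (𝓝 ![0, Δ, 2 * Δ]) (𝓝 0) := by
  intro hT
  have ht : Tendsto (fun m => (![0, Δ, tau Δ m] : Fin 3 → ℝ)) atTop (𝓝 ![0, Δ, 2 * Δ]) := by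
    refine tendsto_pi_nhds.2 fun j => ?_
    fin_cases j
    · exact tendsto_const_nhds
    · exact tendsto_const_nhds
    · exact tendsto_tau Δ
  refine extendedDataset_notMem_closure hE hΔ h (Metric.mem_closure_iff_infEDist_zero.2 ?_)
  -- The distance from the dataset to the limit set does not depend on m. Since the dataset belongs
  -- to the set at every τ_m, that distance is bounded by Hausdorff distances which would tend to 0.
  refine le_antisymm (ge_of_tendsto' (hT.comp ht) fun m => ?_) zero_le
  exact Metric.infEDist_le_hausdorffEDist_of_mem (extendedDataset_mem hE hΔ m)

end TimedMeasurement

theorem mainTheorem12 :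
    (∃ C₁ C₂ : ℝ, 0 < C₁ ∧ 0 < C₂ ∧
      ∀ Eplus Δ δ : ℝ, 0 < Eplus → 0 < Δ → Δ ≤ Real.pi / (2 * Eplus) → 0 ≤ δ →
        ∀ P ∈ softSupportSet (Fin 1) (Fin 2) Eplus (1 / 2), FitsFlip Δ δ P →
          1 - P 0 0 (2 * Δ) ≤ √(C₁ * √δ + C₂ * (Eplus * Δ) ^ 2)) ∧
    (∀ Eplus Δ : ℝ, 0 < Eplus → 0 < Δ →
      (∀ m : ℕ,
        (∃ R : Realization (EuclideanSpace ℂ (Fin 2)) (Fin 1) (Fin 2),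
          R.state = ketbra ketPlus ∧ R.ham = qubitHam Δ m ∧
          R.meas 0 0 = ketbra ketPlus ∧ R.meas 0 1 = 1 - ketbra ketPlus ∧
          R.highEnergyProb Eplus ≤ 1 / 2 ∧ FitsFlip Δ 0 R.timeline ∧
          R.timeline 0 0 (tau Δ m) = 0) ∧
        (∀ δ : ℝ, 0 ≤ δ →
          IsLeast {p : ℝ | ∃ P ∈ softSupportSet (Fin 1) (Fin 2) Eplus (1 / 2),
            FitsFlip Δ δ P ∧ p = P 0 0 (tau Δ m)} 0) ∧
        extendedDataset ∈
          softSupportDatasets (Fin 1) (Fin 2) Eplus (1 / 2) ![0, Δ, tau Δ m]) ∧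
      Tendsto (tau Δ) atTop (𝓝 (2 * Δ))) ∧
    (∃ c : ℝ, 0 < c ∧ ∀ Eplus Δ : ℝ, 0 < Eplus → 0 < Δ → Eplus * Δ ≤ c →
      extendedDataset ∉
        closure (softSupportDatasets (Fin 1) (Fin 2) Eplus (1 / 2) ![0, Δ, 2 * Δ]) ∧
      ¬ Tendsto
        (fun t : Fin 3 → ℝ => Metric.hausdorffEDist
          (softSupportDatasets (Fin 1) (Fin 2) Eplus (1 / 2) t)
          (softSupportDatasets (Fin 1) (Fin 2) Eplus (1 / 2) ![0, Δ, 2 * Δ]))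
        (𝓝 ![0, Δ, 2 * Δ]) (𝓝 0)) := by
  refine ⟨⟨130, 64, by norm_num, by norm_num, fun Eplus Δ δ _ hΔ _ hδ P hP hfit =>
    one_sub_le_sqrt_of_mem_softSupportSet hΔ hδ hP hfit⟩, fun Eplus Δ hE hΔ =>
    ⟨fun m => ⟨⟨qubitRealization Δ hΔ m, rfl, rfl, rfl, rfl,
      highEnergyProb_qubitRealization_le hE hΔ m, fitsFlip_qubitRealization hΔ m,
      timeline_qubitRealization_tau hΔ m⟩, fun δ hδ => isLeast_timeline_tau hE hΔ hδ m,
      extendedDataset_mem hE hΔ m⟩, tendsto_tau Δ⟩,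
    ⟨1 / 32, by norm_num, fun Eplus Δ hE hΔ h =>
      ⟨extendedDataset_notMem_closure hE hΔ h, not_tendsto_hausdorffEDist hE hΔ h⟩⟩⟩
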